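/- Theorem 2.1. Let $Y,Y_1,Y_2,\ldots$ be independent and identically distributed with distribution $F$ on a measurable space, let $\Theta\subseteq\mathbb R^p$ be open and convex (for example $\Theta=\mathbb R^p$), and let $g(y,t)$ be a real-valued function that is convex in $t\in\Theta$ for each $y$. Let $\theta_0\in\Theta$ minimise $E\,g(Y,t)$ over $t\in\Theta$, in the sense that $E\{g(Y,t)-g(Y,\theta_0)\}\ge 0$ for every $t\in\Theta$ for which $g(Y,t)-g(Y,\theta_0)$ is integrable. Suppose that $$g(y,\theta_0+t)-g(y,\theta_0)=D(y)^{\top}t+R(y,t)\qquad\text{whenever }\theta_0+t\in\Theta,$$ where $D(Y)$ takes values in $\mathbb R^p$, has mean zero and has finite covariance matrix $K=E\,D(Y)D(Y)^{\top}$; that $R(Y,t)$ is square-integrable for all $t$ close enough to $0$; and that, as $t\to0$, $$E\,R(Y,t)=\tfrac12 t^{\top}Jt+o(|t|^2),\qquad \operatorname{Var}R(Y,t)=o(|t|^2),$$ for a symmetric positive definite matrix $J$. For each $n$ let $\hat\theta_n$ be a random vector in $\mathbb R^p$ such that, with probability tending to one as $n\to\infty$, $\hat\theta_n\in\Theta$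 and $\hat\theta_n$ minimises $\sum_{i\le n}g(Y_i,t)$ over $t\in\Theta$ (in particular, $\hat\theta_n$ may be any measurable choice of a minimiser, if minimisers exist). Then $\hat\theta_n$ is $\sqrt n$-consistent for $\theta_0$, that is, $\sqrt n(\hat\theta_n-\theta_0)$ is stochastically bounded, and $$\sqrt n(\hat\theta_n-\theta_0)=-J^{-1}n^{-1/2}\sum_{i\le n}D(Y_i)+o_p(1).$$ In particular $\sqrt n(\hat\theta_n-\theta_0)$ converges in distribution to $-J^{-1}N_p(0,K)=N_p(0,J^{-1}KJ^{-1})$, where the equality says that the image of the law $N_p(0,K)$ under $z\mapsto-J^{-1}z$ is $N_p(0,J^{-1}KJ^{-1})$. -/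

import Mathlib

open MeasureTheory ProbabilityTheory Filter Topology Asymptotics
open scoped Matrix ENNReal

/-- `X n = O_p(1)`: the sequence `X` is stochastically bounded under `P`. -/
def IsStochasticallyBounded {Ω E : Type*} [MeasurableSpace Ω] [Norm E]
    (P : Measure Ω) (X : ℕ → Ω → E) : Prop :=
  ∀ ε : ℝ≥0∞, 0 < ε → ∃ M : ℝ, ∀ n, P {ω | M < ‖X n ω‖} ≤ ε

/-- `θhat` is `√n`-consistent for `θ₀`: `√n (θhat n - θ₀) = O_p(1)`. -/
def IsRootNConsistent {Ω E : Type*} [MeasurableSpace Ω] [NormedAddCommGroup E] [NormedSpace ℝ E]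
    (P : Measure Ω) (θhat : ℕ → Ω → E) (θ₀ : E) : Prop :=
  IsStochasticallyBounded P (fun n ω ↦ √(n : ℝ) • (θhat n ω - θ₀))

/-! Rescale by t = s/√n. The centred criterion A_n(s) = ∑ (g(Y_i, θ₀ + s/√n) - g(Y_i, θ₀)) is convex
in s and, by the expansion, equals ⟨U_n, s⟩ + ∑ R(Y_i, s/√n) with U_n = n^{-1/2} ∑ D(Y_i). The
remainder sum has mean tending to ½ sᵀJs and variance tending to 0, so Chebyshev gives A_n(s) -
⟨U_n, s⟩ → ½ sᵀJs in probability for each fixed s (`tendstoInMeasure_sum_of_tendsto_mean_variance`).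

Convexity does the rest. It makes this convergence uniform on compact sets
(`IsCompact.exists_finset_abs_sub_le_of_convexOn`), and it forces a global minimiser of A_n to lie
near β_n = -J⁻¹U_n, the minimiser of the quadratic, with no prior consistency
(`norm_sub_lt_of_isMinOn_of_abs_sub_quadratic_le`). The central limit theorem for U_n and Slutsky's
lemma then give the limit law, hence the stochastic boundedness. -/

/-! ### Convex functions: finite control and localisation of minimisers -/

/-- Near any point, closeness of a convex function to a given continuous function is controlled by
closeness on a finite set. -/
lemma exists_nhds_abs_sub_le_of_convexOn {E : Type*} [NormedAddCommGroup E] [NormedSpace ℝ E]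
    [FiniteDimensional ℝ E] {q : E → ℝ} (hq : Continuous q) {ε : ℝ} (hε : 0 < ε) (x₀ : E) :
    ∃ N ∈ 𝓝 x₀, ∃ T : Finset E, ∀ (S : Set E) (f : E → ℝ), ConvexOn ℝ S f → ↑T ⊆ S →
      (∀ t ∈ T, |f t - q t| ≤ ε / 8) → ∀ x ∈ N, |f x - q x| ≤ ε := by
  classical
  have hV : {x | |q x - q x₀| < ε / 8} ∈ 𝓝 x₀ := by
    refine (isOpen_lt (by fun_prop) continuous_const).mem_nhds ?_
    simpa using hε
  obtain ⟨b, hb, hbV⟩ := exists_mem_interior_convexHull_affineBasis hV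
  set H := convexHull ℝ (Set.range b) with hH
  have hHn : H ∈ 𝓝 x₀ := mem_interior_iff_mem_nhds.1 hb
  -- Values at the vertices bound `f` only from above on the simplex `H`. Lower bounds come from
  -- reflection: f(x) ≥ 2f(x₀) - f(2x₀ - x), so both points must lie in `H`.
  have hrefl : Tendsto (fun x ↦ (2 : ℝ) • x₀ - x) (𝓝 x₀) (𝓝 x₀) := by
    have : Continuous fun x : E ↦ (2 : ℝ) • x₀ - x := by fun_prop
    simpa [two_smul] using this.tendsto x₀
  refine ⟨H ∩ (fun x ↦ (2 : ℝ) • x₀ - x) ⁻¹' H, inter_mem hHn (hrefl hHn),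
    insert x₀ (Finset.univ.image b), fun S f hf hTS hT x hx ↦ ?_⟩
  have hbS : Set.range b ⊆ S := by
    rintro _ ⟨i, rfl⟩
    exact hTS (by simp)
  have hHS : H ⊆ S := convexHull_min hbS hf.1
  have upper : ∀ z ∈ H, f z ≤ q x₀ + ε / 4 := by
    intro z hz
    obtain ⟨_, ⟨i, rfl⟩, hi⟩ := hf.exists_ge_of_mem_convexHull hbS hz
    have h1 := abs_le.1 (hT (b i) (by simp))
    have h2 := abs_lt.1 (show |q (b i) - q x₀| < ε / 8 from
      hbV (subset_convexHull ℝ _ ⟨i, rfl⟩))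
    linarith [h1.2, h2.2]
  have hqx := abs_lt.1 (show |q x - q x₀| < ε / 8 from hbV hx.1)
  have h0 := abs_le.1 (hT x₀ (by simp))
  have hmid := hf.2 (hHS hx.1) (hHS hx.2) (show (0 : ℝ) ≤ 1 / 2 by norm_num)
    (show (0 : ℝ) ≤ 1 / 2 by norm_num) (by norm_num)
  have hpt : (1 / 2 : ℝ) • x + (1 / 2 : ℝ) • ((2 : ℝ) • x₀ - x) = x₀ := by module
  rw [hpt, smul_eq_mul, smul_eq_mul] at hmid
  have h3 := upper x hx.1
  have h4 := upper _ hx.2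
  rw [abs_le]
  constructor <;> linarith [h0.1, hqx.1, hqx.2]

/-- On a compact set, uniform closeness of a convex function to a given continuous function is
controlled by closeness on a finite set. -/
lemma IsCompact.exists_finset_abs_sub_le_of_convexOn {E : Type*} [NormedAddCommGroup E]
    [NormedSpace ℝ E] [FiniteDimensional ℝ E] {C : Set E} (hC : IsCompact C) {q : E → ℝ}
    (hq : Continuous q) {ε : ℝ} (hε : 0 < ε) :
    ∃ T : Finset E, ∀ (S : Set E) (f : E → ℝ), ConvexOn ℝ S f → ↑T ⊆ S →
      (∀ t ∈ T, |f t - q t| ≤ ε / 8) → ∀ x ∈ C, |f x - q x| ≤ ε := by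
  classical
  refine hC.induction_on (p := fun C ↦ ∃ T : Finset E, ∀ (S : Set E) (f : E → ℝ),
    ConvexOn ℝ S f → ↑T ⊆ S → (∀ t ∈ T, |f t - q t| ≤ ε / 8) → ∀ x ∈ C, |f x - q x| ≤ ε)
    ⟨∅, by simp⟩ ?_ ?_ ?_
  · rintro s t hst ⟨T, hT⟩
    exact ⟨T, fun S f hf hTS h x hx ↦ hT S f hf hTS h x (hst hx)⟩
  · rintro s t ⟨T, hT⟩ ⟨T', hT'⟩
    refine ⟨T ∪ T', fun S f hf hTS h x hx ↦ ?_⟩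
    rw [Finset.coe_union, Set.union_subset_iff] at hTS
    rcases hx with hx | hx
    · exact hT S f hf hTS.1 (fun t ht ↦ h t (Finset.mem_union_left _ ht)) x hx
    · exact hT' S f hf hTS.2 (fun t ht ↦ h t (Finset.mem_union_right _ ht)) x hx
  · intro x _
    obtain ⟨N, hN, T, hT⟩ := exists_nhds_abs_sub_le_of_convexOn hq hε x
    exact ⟨N, mem_nhdsWithin_of_mem_nhds hN, T, hT⟩

/-- A minimiser of a convex function that is close, on the ball of radius `δ` about `β`, to a
coercive quadratic function with minimiser `β` lies in the interior of that ball. -/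
lemma norm_sub_lt_of_isMinOn_of_abs_sub_quadratic_le {E : Type*} [NormedAddCommGroup E]
    [InnerProductSpace ℝ E] {S : Set E} {A : E → ℝ} (hA : ConvexOn ℝ S A) {L : E →ₗ[ℝ] E}
    (hL : L.IsSymmetric) {c : ℝ} (hc : ∀ x, c * ‖x‖ ^ 2 ≤ inner ℝ x (L x)) {u β z : E}
    (hβ : L β = -u) {δ ε : ℝ} (hδ : 0 < δ) (hε : 4 * ε < c * δ ^ 2)
    (hS : Metric.closedBall β δ ⊆ S)
    (happrox : ∀ s ∈ Metric.closedBall β δ,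
      |A s - inner ℝ u s - 1 / 2 * inner ℝ s (L s)| ≤ ε)
    (hz : z ∈ S) (hmin : IsMinOn A S z) : ‖z - β‖ < δ := by
  by_contra! hlt
  have hpos : 0 < ‖z - β‖ := hδ.trans_le hlt
  -- `β + v` is where the segment from `β` to `z` meets the sphere of radius `δ`. Convexity gives
  -- A(β + v) ≤ A(β), yet the quadratic grows there by at least cδ²/2 > 2ε.
  set a := δ / ‖z - β‖ with ha
  have ha0 : 0 ≤ a := by positivity
  have ha1 : a ≤ 1 := (div_le_one hpos).2 hlt
  set v := a • (z - β) with hv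
  have hvn : ‖v‖ = δ := by
    rw [hv, norm_smul, Real.norm_of_nonneg ha0, ha, div_mul_cancel₀ _ hpos.ne']
  have hβball : β ∈ Metric.closedBall β δ := Metric.mem_closedBall_self hδ.le
  have hsball : β + v ∈ Metric.closedBall β δ := by simp [hvn]
  have hle : A (β + v) ≤ A β := by
    have h := hA.2 hz (hS hβball) ha0 (sub_nonneg.2 ha1) (by ring)
    have hpt : a • z + (1 - a) • β = β + v := by rw [hv]; module
    rw [hpt, smul_eq_mul, smul_eq_mul] at h
    have hm : A z ≤ A β := hmin (hS hβball)
    nlinarith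
  have h1 := abs_le.1 (happrox _ hβball)
  have h2 := abs_le.1 (happrox _ hsball)
  have hsymm : (inner ℝ β (L v) : ℝ) = inner ℝ v (L β) := by
    rw [← hL β v, real_inner_comm]
  have hu : (inner ℝ v (L β) : ℝ) = -inner ℝ u v := by
    rw [hβ, inner_neg_right, real_inner_comm]
  have hq : (inner ℝ u (β + v) : ℝ) + 1 / 2 * inner ℝ (β + v) (L (β + v)) =
      inner ℝ u β + 1 / 2 * inner ℝ β (L β) + 1 / 2 * inner ℝ v (L v) := by
    rw [map_add, inner_add_right, inner_add_left, inner_add_right, inner_add_right, hsymm, hu]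
    ring
  have hcv := hc v
  rw [hvn] at hcv
  linarith [h1.2, h2.1]

/-! ### Weak law and the n^{-1/2} scaling -/

/-- Weak law of large numbers for the sums of a triangular array of identically distributed,
row-wise independent variables `f n (Y i)`. -/
lemma tendstoInMeasure_sum_of_tendsto_mean_variance {𝓨 Ω : Type*} [MeasurableSpace 𝓨]
    [MeasurableSpace Ω] {P : Measure Ω} [IsProbabilityMeasure P] {F : Measure 𝓨}
    {Y : ℕ → Ω → 𝓨} (hlaw : ∀ i, HasLaw (Y i) F P) (hindep : iIndepFun Y P)
    {f : ℕ → 𝓨 → ℝ} (hf : ∀ᶠ n in atTop, MemLp (f n) 2 F) {m : ℝ}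
    (hmean : Tendsto (fun n : ℕ ↦ n * ∫ y, f n y ∂F) atTop (𝓝 m))
    (hvar : Tendsto (fun n : ℕ ↦ n * Var[f n; F]) atTop (𝓝 0)) :
    TendstoInMeasure P (fun n ω ↦ ∑ i ∈ Finset.range n, f n (Y i ω)) atTop (fun _ ↦ m) := by
  rw [tendstoInMeasure_iff_norm]
  intro ε hε
  have hbound : ∀ᶠ n : ℕ in atTop, P {ω | ε ≤ ‖∑ i ∈ Finset.range n, f n (Y i ω) - m‖} ≤
      ENNReal.ofReal (n * Var[f n; F] / (ε / 2) ^ 2) := by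
    filter_upwards [hf, Metric.tendsto_nhds.1 hmean (ε / 2) (by positivity)] with n hn hmn
    have hLp : ∀ i, MemLp (f n ∘ Y i) 2 P := fun i ↦
      MemLp.comp_of_map (by rw [(hlaw i).map_eq]; exact hn) (hlaw i).aemeasurable
    have hint : ∀ i, ∫ ω, (f n ∘ Y i) ω ∂P = ∫ y, f n y ∂F := fun i ↦
      (hlaw i).integral_comp hn.aestronglyMeasurable
    have hv : ∀ i, Var[f n ∘ Y i; P] = Var[f n; F] := fun i ↦ by
      rw [← (hlaw i).map_eq, variance_map _ (hlaw i).aemeasurable]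
      rw [(hlaw i).map_eq]; exact hn.aestronglyMeasurable.aemeasurable
    have hind : iIndepFun (fun i ↦ f n ∘ Y i) P :=
      hindep.comp₀ (fun _ ↦ f n) (fun i ↦ (hlaw i).aemeasurable)
        (fun i ↦ by rw [(hlaw i).map_eq]; exact hn.aestronglyMeasurable.aemeasurable)
    set X : Ω → ℝ := ∑ i ∈ Finset.range n, f n ∘ Y i with hX
    have hXLp : MemLp X 2 P := memLp_finsetSum' _ fun i _ ↦ hLp i
    have hXv : Var[X; P] = n * Var[f n; F] := by
      rw [hX, IndepFun.variance_sum (fun i _ ↦ hLp i)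
        (fun i _ j _ hij ↦ hind.indepFun hij)]
      simp [hv]
    have hXm : ∫ ω, X ω ∂P = n * ∫ y, f n y ∂F := by
      simp_rw [hX, Finset.sum_apply]
      rw [integral_finsetSum _ fun i _ ↦ (hLp i).integrable (by norm_num)]
      simp only [hint, Finset.sum_const, Finset.card_range, nsmul_eq_mul]
    rw [← hXv]
    -- Chebyshev at distance ε/2 from the mean; the other ε/2 covers the gap between the mean and
    -- `m`.
    refine (measure_mono fun ω hω ↦ ?_).trans (meas_ge_le_variance_div_sq hXLp (half_pos hε))
    simp only [Set.mem_ofPred_eq, hXm] at hω ⊢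
    have hXω : X ω = ∑ i ∈ Finset.range n, f n (Y i ω) := by simp [hX]
    rw [← hXω, Real.norm_eq_abs] at hω
    rw [Real.dist_eq] at hmn
    have := abs_sub_le (X ω) (n * ∫ y, f n y ∂F) m
    linarith
  have hlim : Tendsto (fun n : ℕ ↦ ENNReal.ofReal (n * Var[f n; F] / (ε / 2) ^ 2)) atTop
      (𝓝 0) := by
    simpa using ENNReal.tendsto_ofReal (hvar.div_const ((ε / 2) ^ 2))
  exact tendsto_of_tendsto_of_tendsto_of_le_of_le' tendsto_const_nhds hlim
    (.of_forall fun _ ↦ zero_le) hbound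

lemma tendsto_inv_sqrt_natCast_smul {E : Type*} [NormedAddCommGroup E] [NormedSpace ℝ E] (s : E) :
    Tendsto (fun n : ℕ ↦ (√(n : ℝ))⁻¹ • s) atTop (𝓝 0) := by
  have h : Tendsto (fun n : ℕ ↦ (√(n : ℝ))⁻¹) atTop (𝓝 0) :=
    tendsto_inv_atTop_zero.comp (Real.tendsto_sqrt_atTop.comp tendsto_natCast_atTop_atTop)
  simpa using h.smul_const s

/-- At t = s/√n, ‖t‖² is ‖s‖²/n, which the factor n cancels. Serves both the mean and the variance
of the remainder. -/
lemma tendsto_natCast_mul_of_isLittleO_norm_sq {E : Type*} [NormedAddCommGroup E]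
    [NormedSpace ℝ E] {r : E → ℝ} (hr : r =o[𝓝 0] fun t ↦ ‖t‖ ^ 2) (s : E) :
    Tendsto (fun n : ℕ ↦ n * r ((√(n : ℝ))⁻¹ • s)) atTop (𝓝 0) := by
  have h := hr.comp_tendsto (tendsto_inv_sqrt_natCast_smul s)
  have h1 : (fun n : ℕ ↦ (n : ℝ) * r ((√(n : ℝ))⁻¹ • s)) =o[atTop]
      fun n : ℕ ↦ (n : ℝ) * ‖(√(n : ℝ))⁻¹ • s‖ ^ 2 := (isBigO_refl _ _).mul_isLittleO h
  have h2 : (fun n : ℕ ↦ (n : ℝ) * ‖(√(n : ℝ))⁻¹ • s‖ ^ 2) =O[atTop] fun _ ↦ (1 : ℝ) := by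
    refine IsBigO.of_bound (‖s‖ ^ 2) ?_
    filter_upwards [eventually_gt_atTop 0] with n hn
    have hn' : (0 : ℝ) < n := by exact_mod_cast hn
    rw [norm_smul, mul_pow, norm_inv, inv_pow, Real.norm_of_nonneg (Real.sqrt_nonneg _),
      Real.sq_sqrt hn'.le, ← mul_assoc, mul_inv_cancel₀ hn'.ne']
    simp
  exact (isLittleO_one_iff ℝ).1 (h1.trans_isBigO h2)

/-! ### Central limit theorem, Gaussian images, tightness -/

/-- The quadratic form of the second moment matrix of a square-integrable vector. -/
lemma dotProduct_mulVec_eq_integral_inner_sq {ι 𝓨 : Type*} [Fintype ι] [MeasurableSpace 𝓨]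
    {F : Measure 𝓨} {D : 𝓨 → EuclideanSpace ℝ ι} (hD : MemLp D 2 F) {K : Matrix ι ι ℝ}
    (hK : ∀ i j, K i j = ∫ y, D y i * D y j ∂F) (t : EuclideanSpace ℝ ι) :
    t.ofLp ⬝ᵥ K *ᵥ t.ofLp = ∫ y, inner ℝ t (D y) ^ 2 ∂F := by
  have hint : ∀ i j, Integrable (fun y ↦ D y i * D y j) F := fun i j ↦
    (hD.eval_piLp i).integrable_mul (hD.eval_piLp j)
  have hsq : ∀ y, (inner ℝ t (D y) : ℝ) ^ 2 = ∑ i, ∑ j, t i * t j * (D y i * D y j) := by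
    intro y
    rw [PiLp.inner_apply, sq, Finset.sum_mul_sum]
    refine Finset.sum_congr rfl fun i _ ↦ Finset.sum_congr rfl fun j _ ↦ ?_
    simp only [RCLike.inner_apply, conj_trivial]
    ring
  simp_rw [hsq]
  rw [integral_finsetSum _ fun i _ ↦ integrable_finsetSum _ fun j _ ↦ (hint i j).const_mul _]
  simp_rw [dotProduct, Matrix.mulVec, dotProduct, Finset.mul_sum]
  refine Finset.sum_congr rfl fun i _ ↦ ?_
  rw [integral_finsetSum _ fun j _ ↦ (hint i j).const_mul _]
  refine Finset.sum_congr rfl fun j _ ↦ ?_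
  rw [integral_const_mul, hK]
  ring

/-- The second moment matrix of a square-integrable vector is positive semidefinite. -/
lemma posSemidef_of_eq_integral_mul {ι 𝓨 : Type*} [Fintype ι] [MeasurableSpace 𝓨]
    {F : Measure 𝓨} {D : 𝓨 → EuclideanSpace ℝ ι} (hD : MemLp D 2 F) {K : Matrix ι ι ℝ}
    (hK : ∀ i j, K i j = ∫ y, D y i * D y j ∂F) : K.PosSemidef := by
  refine .of_dotProduct_mulVec_nonneg ?_ fun x ↦ ?_
  · ext i j
    simp [hK, mul_comm]
  · rw [star_trivial]
    exact (dotProduct_mulVec_eq_integral_inner_sq hD hK (WithLp.toLp 2 x)).symm ▸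
      integral_nonneg fun _ ↦ sq_nonneg _

/-- **Multivariate central limit theorem** for centred square-integrable functions of independent
identically distributed variables. -/
theorem tendstoInDistribution_inv_sqrt_smul_sum {ι 𝓨 Ω : Type*} [Fintype ι] [DecidableEq ι]
    [MeasurableSpace 𝓨] [MeasurableSpace Ω] {P : Measure Ω} [IsProbabilityMeasure P]
    {F : Measure 𝓨} [IsProbabilityMeasure F] {Y : ℕ → Ω → 𝓨}
    (hlaw : ∀ i, HasLaw (Y i) F P) (hindep : iIndepFun Y P) {D : 𝓨 → EuclideanSpace ℝ ι}
    (hD : MemLp D 2 F) (hD_mean : ∫ y, D y ∂F = 0) {K : Matrix ι ι ℝ} (hK_psd : K.PosSemidef)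
    (hK : ∀ i j, K i j = ∫ y, D y i * D y j ∂F) :
    TendstoInDistribution (fun (n : ℕ) ω ↦ (√(n : ℝ))⁻¹ • ∑ i ∈ Finset.range n, D (Y i ω)) atTop
      id (fun _ ↦ P) (multivariateGaussian 0 K) := by
  have hm : ∀ i, AEMeasurable (fun ω ↦ D (Y i ω)) P := fun i ↦
    AEMeasurable.comp_aemeasurable (by rw [(hlaw i).map_eq]; exact hD.1.aemeasurable)
      (hlaw i).aemeasurable
  have hU : ∀ n : ℕ, AEMeasurable
      (fun ω ↦ (√(n : ℝ))⁻¹ • ∑ i ∈ Finset.range n, D (Y i ω)) P := fun n ↦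
    AEMeasurable.fun_const_smul (Finset.aemeasurable_fun_sum _ fun i _ ↦ hm i) _
  refine ⟨hU, by fun_prop, ?_⟩
  refine ProbabilityMeasure.tendsto_iff_tendsto_charFun.2 fun t ↦ ?_
  -- Cramér–Wold: the characteristic function of the vector at `t` is that of its projection on `t`
  -- at 1.
  set x : 𝓨 → ℝ := fun y ↦ inner ℝ t (D y) with hx
  have hxLp : MemLp x 2 F := hD.const_inner t
  have hxY : ∀ i, HasLaw (x ∘ Y i) (F.map x) P := fun i ↦
    HasLaw.comp ⟨hxLp.1.aemeasurable, rfl⟩ (hlaw i)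
  have hmean : ∫ ω, (x ∘ Y 0) ω ∂P = 0 := by
    rw [(hlaw 0).integral_comp hxLp.1, hx, integral_inner (hD.integrable (by norm_num)), hD_mean,
      inner_zero_right]
  have hvar : Var[x ∘ Y 0; P] = t.ofLp ⬝ᵥ K *ᵥ t.ofLp := by
    rw [variance_of_integral_eq_zero (hxY 0).aemeasurable hmean,
      dotProduct_mulVec_eq_integral_inner_sq hD hK]
    exact (hlaw 0).integral_comp (f := fun y ↦ x y ^ 2) (hxLp.1.pow 2)
  have hclt := tendstoInDistribution_inv_sqrt_mul_sum_sub (X := fun i ↦ x ∘ Y i) (P := P)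
    (HasLaw.id (μ := gaussianReal 0 Var[x ∘ Y 0; P].toNNReal))
    (MemLp.comp_of_map (by rw [(hlaw 0).map_eq]; exact hxLp) (hlaw 0).aemeasurable)
    (hindep.comp₀ (fun _ ↦ x) (fun i ↦ (hlaw i).aemeasurable)
      fun i ↦ by rw [(hlaw i).map_eq]; exact hxLp.1.aemeasurable)
    fun i ↦ ⟨(hxY i).aemeasurable, (hxY 0).aemeasurable, (hxY i).map_eq.trans (hxY 0).map_eq.symm⟩
  have hlim := ProbabilityMeasure.tendsto_iff_tendsto_charFun.1 hclt.tendsto 1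
  simp only [ProbabilityMeasure.coe_mk, Measure.map_id, hmean, mul_zero, sub_zero] at hlim ⊢
  convert hlim using 1
  · ext n
    rw [charFun_eq_charFunDual_toDualMap, charFunDual_eq_charFun_map_one,
      AEMeasurable.map_map_of_aemeasurable (by fun_prop) (hU n)]
    congr 2
    ext ω
    simp [hx]
  · rw [charFun_multivariateGaussian hK_psd, charFun_gaussianReal,
      Real.coe_toNNReal _ (variance_nonneg _ _), hvar]
    simp

/-- The image of a centred Gaussian law under a linear map. -/
lemma map_toEuclideanCLM_multivariateGaussian {ι : Type*} [Fintype ι] [DecidableEq ι]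
    {K : Matrix ι ι ℝ} (hK : K.PosSemidef) (A : Matrix ι ι ℝ) :
    (multivariateGaussian 0 K).map (Matrix.toEuclideanCLM (𝕜 := ℝ) A) =
      multivariateGaussian 0 (A * K * Aᵀ) := by
  have hK' : (A * K * Aᵀ).PosSemidef := by
    simpa using hK.mul_mul_conjTranspose_same A
  apply IsGaussian.ext
  · simp only [id_eq, integral_id_multivariateGaussian]
    rw [ContinuousLinearMap.integral_id_map IsGaussian.integrable_id,
      integral_id_multivariateGaussian, map_zero]
  · ext x y
    rw [covarianceBilin_map IsGaussian.memLp_two_id, covarianceBilin_multivariateGaussian hK,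
      covarianceBilin_multivariateGaussian hK', ← ContinuousLinearMap.star_eq_adjoint, ← map_star]
    simp only [Matrix.ofLp_toEuclideanCLM, Matrix.star_eq_conjTranspose,
      Matrix.conjTranspose_eq_transpose_of_trivial]
    rw [← Matrix.mulVec_mulVec, ← Matrix.mulVec_mulVec, Matrix.mulVec_transpose A x.ofLp,
      Matrix.dotProduct_mulVec x.ofLp A]

/-- A sequence that converges in distribution is stochastically bounded. -/
lemma MeasureTheory.TendstoInDistribution.isStochasticallyBounded {Ω Ω' E : Type*}
    [MeasurableSpace Ω] [MeasurableSpace Ω'] [NormedAddCommGroup E] [InnerProductSpace ℝ E]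
    [FiniteDimensional ℝ E] [MeasurableSpace E] [BorelSpace E] {P : Measure Ω}
    [IsProbabilityMeasure P] {P' : Measure Ω'} [IsProbabilityMeasure P'] {X : ℕ → Ω → E}
    {Z : Ω' → E} (h : TendstoInDistribution X atTop Z (fun _ ↦ P) P') :
    IsStochasticallyBounded P X := by
  have hprob : ∀ n, IsProbabilityMeasure (P.map (X n)) := fun n ↦
    Measure.isProbabilityMeasure_map (h.forall_aemeasurable n)
  have hprob' : IsProbabilityMeasure (P'.map Z) :=
    Measure.isProbabilityMeasure_map h.aemeasurable_limit
  -- Lévy: pointwise convergence of characteristic functions to a continuous limit gives tightness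
  -- of the whole sequence, so one `M` serves every n.
  have htight : IsTightMeasureSet (Set.range fun n ↦ P.map (X n)) :=
    isTightMeasureSet_of_tendsto_charFun (f := charFun (P'.map Z)) (by fun_prop)
      (ProbabilityMeasure.tendsto_iff_tendsto_charFun.1 h.tendsto)
  intro ε hε
  obtain ⟨M, hM⟩ := (ENNReal.tendsto_nhds_zero.1
    (tendsto_measure_norm_gt_of_isTightMeasureSet htight) ε hε).exists
  refine ⟨M, fun n ↦ ?_⟩
  have hn := (le_iSup₂ (f := fun (μ : Measure E) (_ : μ ∈ Set.range fun n ↦ P.map (X n)) ↦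
    μ {x | M < ‖x‖}) _ ⟨n, rfl⟩).trans hM
  rwa [Measure.map_apply_of_aemeasurable (h.forall_aemeasurable n)
    (measurableSet_lt measurable_const measurable_norm)] at hn

/-! ### Minimisers of asymptotically quadratic convex processes -/

/-- **Minimisers of convex processes**: if the convex random functions `A n` are asymptotically
quadratic, pointwise in probability, then their minimisers are asymptotically equivalent to the
minimisers `β n` of the approximating quadratic functions, provided these are stochastically
bounded. -/
theorem tendstoInMeasure_sub_of_isMinOn_convex {Ω E : Type*} [MeasurableSpace Ω]
    [NormedAddCommGroup E] [InnerProductSpace ℝ E] [FiniteDimensional ℝ E] {P : Measure Ω}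
    {S : ℕ → Set E} (hS : ∀ C, IsCompact C → ∀ᶠ n in atTop, C ⊆ S n)
    {A : ℕ → Ω → E → ℝ} (hA : ∀ n ω, ConvexOn ℝ (S n) (A n ω))
    {L : E →ₗ[ℝ] E} (hL : L.IsSymmetric) {c : ℝ} (hc0 : 0 < c)
    (hc : ∀ x, c * ‖x‖ ^ 2 ≤ inner ℝ x (L x))
    {U β z : ℕ → Ω → E} (hβ : ∀ n ω, L (β n ω) = -U n ω) (hβ_bdd : IsStochasticallyBounded P β)
    (hlim : ∀ s, TendstoInMeasure P (fun n ω ↦ A n ω s - inner ℝ (U n ω) s) atTop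
      (fun _ ↦ 1 / 2 * inner ℝ s (L s)))
    (hz : Tendsto (fun n ↦ P {ω | ¬ (z n ω ∈ S n ∧ IsMinOn (A n ω) (S n) (z n ω))}) atTop (𝓝 0)) :
    TendstoInMeasure P (fun n ω ↦ z n ω - β n ω) atTop 0 := by
  rw [tendstoInMeasure_iff_norm]
  intro δ hδ
  rw [ENNReal.tendsto_nhds_zero]
  intro η hη
  obtain ⟨M, hM⟩ := hβ_bdd (η / 2) (ENNReal.half_pos hη.ne')
  set ε := c * δ ^ 2 / 8 with hε
  have hε0 : 0 < ε := by positivity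
  have hLc : Continuous L := L.continuous_of_finiteDimensional
  -- `T` depends on neither n nor ω, so pointwise convergence in probability and a finite union
  -- bound suffice.
  obtain ⟨T, hT⟩ := (isCompact_closedBall (0 : E) (M + δ)).exists_finset_abs_sub_le_of_convexOn
    (q := fun s ↦ 1 / 2 * inner ℝ s (L s)) (by fun_prop) hε0
  have hsmall : Tendsto (fun n ↦ P {ω | ¬ (z n ω ∈ S n ∧ IsMinOn (A n ω) (S n) (z n ω))} +
      ∑ t ∈ T, P {ω | ε / 8 ≤ ‖A n ω t - inner ℝ (U n ω) t - 1 / 2 * inner ℝ t (L t)‖})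
      atTop (𝓝 0) := by
    simpa using hz.add (tendsto_finsetSum T fun t _ ↦
      tendstoInMeasure_iff_norm.1 (hlim t) (ε / 8) (by positivity))
  filter_upwards [ENNReal.tendsto_nhds_zero.1 hsmall (η / 2) (ENNReal.half_pos hη.ne'),
    hS _ (isCompact_closedBall 0 (M + δ)), hS _ T.finite_toSet.isCompact] with n hn hball hTS
  have hsub : {ω | δ ≤ ‖z n ω - β n ω - (0 : Ω → E) ω‖} ⊆
      ({ω | ¬ (z n ω ∈ S n ∧ IsMinOn (A n ω) (S n) (z n ω))} ∪
      ⋃ t ∈ T, {ω | ε / 8 ≤ ‖A n ω t - inner ℝ (U n ω) t - 1 / 2 * inner ℝ t (L t)‖}) ∪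
      {ω | M < ‖β n ω‖} := by
    intro ω hω
    by_contra hcon
    simp only [Set.mem_union, Set.mem_iUnion, Set.mem_ofPred_eq, not_or, not_not, not_exists,
      not_le, not_lt] at hcon
    obtain ⟨⟨⟨hzS, hzmin⟩, hTω⟩, hβω⟩ := hcon
    have hsubball : Metric.closedBall (β n ω) δ ⊆ Metric.closedBall 0 (M + δ) :=
      Metric.closedBall_subset_closedBall' (by rw [dist_zero_right]; linarith)
    have hconv : ConvexOn ℝ (S n) fun s ↦ A n ω s - inner ℝ (U n ω) s :=
      -- Subtracting the random linear term keeps convexity and leaves a deterministic limit.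
      (hA n ω).sub ((innerₗ E (U n ω)).concaveOn (hA n ω).1)
    have happrox := hT (S n) _ hconv hTS fun t ht ↦ (hTω t ht).le
    refine absurd (norm_sub_lt_of_isMinOn_of_abs_sub_quadratic_le (hA n ω) hL hc (hβ n ω) hδ
      (ε := ε) (by rw [hε]; nlinarith [mul_pos hc0 (pow_pos hδ 2)]) (hsubball.trans hball)
      (fun s hs ↦ happrox s (hsubball hs)) hzS hzmin) (not_lt.2 ?_)
    simpa using hω
  calc P {ω | δ ≤ ‖z n ω - β n ω - (0 : Ω → E) ω‖}
      ≤ P _ := measure_mono hsub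
    _ ≤ _ := (measure_union_le _ _).trans <| add_le_add ((measure_union_le _ _).trans <|
        add_le_add_right (measure_biUnion_finset_le _ _) _) le_rfl
    _ ≤ η / 2 + η / 2 := add_le_add hn (hM n)
    _ = η := ENNReal.add_halves η

/-- A positive definite matrix has a coercive quadratic form. -/
lemma Matrix.PosDef.exists_pos_mul_norm_sq_le_inner {ι : Type*} [Fintype ι] [DecidableEq ι]
    {J : Matrix ι ι ℝ} (hJ : J.PosDef) :
    ∃ c > 0, ∀ x : EuclideanSpace ℝ ι, c * ‖x‖ ^ 2 ≤ inner ℝ x (J.toEuclideanLin x) := by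
  have hcont : Continuous fun x : EuclideanSpace ℝ ι ↦ inner ℝ x (J.toEuclideanLin x) :=
    continuous_id.inner (LinearMap.continuous_of_finiteDimensional _)
  have hpos : ∀ x : EuclideanSpace ℝ ι, x ≠ 0 → 0 < inner ℝ x (J.toEuclideanLin x) := by
    intro x hx
    have h := hJ.dotProduct_mulVec_pos (x := x.ofLp) (by simpa using hx)
    rw [star_trivial] at h
    exact (Matrix.inner_toEuclideanCLM J x x).symm ▸ h
  -- The unit sphere is empty when the space is trivial.
  rcases (Metric.sphere (0 : EuclideanSpace ℝ ι) 1).eq_empty_or_nonempty with hemp | hne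
  · refine ⟨1, one_pos, fun x ↦ ?_⟩
    by_cases hx : x = 0
    · simp [hx]
    · have : ‖x‖⁻¹ • x ∈ Metric.sphere (0 : EuclideanSpace ℝ ι) 1 := by
        simp [norm_smul, hx]
      simp [hemp] at this
  · obtain ⟨x₀, hx₀, hmin⟩ := (isCompact_sphere (0 : EuclideanSpace ℝ ι) 1).exists_isMinOn hne
      hcont.continuousOn
    have hx₀' : x₀ ≠ 0 := by
      rintro rfl
      simp at hx₀
    refine ⟨_, hpos x₀ hx₀', fun x ↦ ?_⟩
    by_cases hx : x = 0
    · simp [hx]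
    · have hxn : 0 < ‖x‖ := norm_pos_iff.2 hx
      have h := hmin (show ‖x‖⁻¹ • x ∈ Metric.sphere (0 : EuclideanSpace ℝ ι) 1 by
        simp [norm_smul, hx])
      simp only [Set.mem_ofPred_eq, map_smul, inner_smul_left, inner_smul_right, conj_trivial] at h
      calc _ ≤ ‖x‖⁻¹ * (‖x‖⁻¹ * inner ℝ x (J.toEuclideanLin x)) * ‖x‖ ^ 2 := by gcongr
        _ = inner ℝ x (J.toEuclideanLin x) := by field_simp

/-- The rescaled neighbourhoods `√n (Θ - θ₀)` of the origin eventually contain any compact set. -/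
lemma IsCompact.eventually_add_inv_sqrt_smul_mem {E : Type*} [NormedAddCommGroup E]
    [NormedSpace ℝ E] {C : Set E} (hC : IsCompact C) {Θ : Set E} {θ₀ : E} (hΘ : Θ ∈ 𝓝 θ₀) :
    ∀ᶠ n : ℕ in atTop, C ⊆ {s | θ₀ + (√(n : ℝ))⁻¹ • s ∈ Θ} := by
  obtain ⟨r, hr, hrΘ⟩ := Metric.mem_nhds_iff.1 hΘ
  obtain ⟨B, hB⟩ := hC.isBounded.exists_norm_le
  filter_upwards [Metric.tendsto_nhds.1 (tendsto_inv_sqrt_natCast_smul B) r hr] with n hn s hs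
  refine hrΘ ?_
  rw [mem_ball_iff_norm, add_sub_cancel_left, norm_smul]
  rw [dist_zero_right, norm_smul] at hn
  refine lt_of_le_of_lt ?_ hn
  gcongr
  exact (hB s hs).trans (le_abs_self B)

/-- A sum of convex functions, evaluated along `s ↦ x + a • s` and centred, is convex. -/
lemma convexOn_sum_sub_const_comp_add_smul {ι E : Type*} [AddCommGroup E] [Module ℝ E]
    {Θ : Set E} (hΘ : Convex ℝ Θ) {f : ι → E → ℝ} (hf : ∀ i, ConvexOn ℝ Θ (f i)) (I : Finset ι)
    (a : ℝ) (x : E) (b : ι → ℝ) :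
    ConvexOn ℝ {s | x + a • s ∈ Θ} fun s ↦ ∑ i ∈ I, (f i (x + a • s) - b i) := by
  classical
  have hS : {s | x + a • s ∈ Θ} =
      (a • LinearMap.id : E →ₗ[ℝ] E) ⁻¹' ((fun z ↦ x + z) ⁻¹' Θ) := by
    ext
    simp
  rw [hS]
  have hconv := (hΘ.translate_preimage_right x).linear_preimage (a • LinearMap.id : E →ₗ[ℝ] E)
  induction I using Finset.induction_on with
  | empty => simpa using convexOn_const 0 hconv
  | insert i I hi ih =>
    simp only [Finset.sum_insert hi]
    exact (ConvexOn.sub (((hf i).translate_right x).comp_linearMap (a • LinearMap.id))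
      (concaveOn_const (b i) hconv)).add ih

/-! ### The main theorem -/

theorem theorem2p1 {p : ℕ} {𝓨 Ω : Type*} [MeasurableSpace 𝓨] [MeasurableSpace Ω]
    (P : Measure Ω) [IsProbabilityMeasure P]
    (F : Measure 𝓨) [IsProbabilityMeasure F]
    -- the i.i.d. observations, with common distribution `F`
    (Y : ℕ → Ω → 𝓨) (hlaw : ∀ i, HasLaw (Y i) F P) (hindep : iIndepFun Y P)
    -- the parameter region and the convex criterion function
    (Θ : Set (EuclideanSpace ℝ (Fin p))) (hΘ_open : IsOpen Θ)
    (g : 𝓨 → EuclideanSpace ℝ (Fin p) → ℝ) (hg : ∀ y, ConvexOn ℝ Θ (g y))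
    -- `θ₀` minimises `E g(Y, t)`, expressed through differences, so that `E g(Y, θ₀)` itself
    -- need not be finite
    (θ₀ : EuclideanSpace ℝ (Fin p)) (hθ₀ : θ₀ ∈ Θ)
    (hmin : ∀ t ∈ Θ, Integrable (fun y ↦ g y t - g y θ₀) F → 0 ≤ ∫ y, (g y t - g y θ₀) ∂F)
    -- the expansion of `g` around `θ₀`
    (D : 𝓨 → EuclideanSpace ℝ (Fin p)) (R : 𝓨 → EuclideanSpace ℝ (Fin p) → ℝ)
    (hexp : ∀ y t, θ₀ + t ∈ Θ → g y (θ₀ + t) - g y θ₀ = inner ℝ (D y) t + R y t)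
    -- `D(Y)` has mean zero and finite covariance matrix `K`
    (hD : MemLp D 2 F) (hD_mean : ∫ y, D y ∂F = 0)
    (K : Matrix (Fin p) (Fin p) ℝ) (hK : ∀ i j, K i j = ∫ y, D y i * D y j ∂F)
    -- mean and variance of the remainder
    (J : Matrix (Fin p) (Fin p) ℝ) (hJ : J.PosDef)
    (hR : ∀ᶠ t in 𝓝 0, MemLp (fun y ↦ R y t) 2 F)
    (hR_mean : (fun t ↦ (∫ y, R y t ∂F) - 1 / 2 * inner ℝ t (J.toEuclideanLin t))
      =o[𝓝 0] fun t ↦ ‖t‖ ^ 2)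
    (hR_var : (fun t ↦ Var[fun y ↦ R y t; F]) =o[𝓝 0] fun t ↦ ‖t‖ ^ 2)
    -- the estimator minimises the empirical criterion, with probability tending to one
    (θhat : ℕ → Ω → EuclideanSpace ℝ (Fin p)) (hθhat_meas : ∀ n, AEMeasurable (θhat n) P)
    (hθhat : Tendsto (fun n ↦ P {ω | ¬ (θhat n ω ∈ Θ ∧
        IsMinOn (fun t ↦ ∑ i ∈ Finset.range n, g (Y i ω) t) Θ (θhat n ω))}) atTop (𝓝 0)) :
    IsRootNConsistent P θhat θ₀ ∧
    TendstoInMeasure P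
      (fun (n : ℕ) ω ↦ √(n : ℝ) • (θhat n ω - θ₀) -
        -(J⁻¹.toEuclideanLin ((√(n : ℝ))⁻¹ • ∑ i ∈ Finset.range n, D (Y i ω))))
      atTop 0 ∧
    TendstoInDistribution (fun (n : ℕ) ω ↦ √(n : ℝ) • (θhat n ω - θ₀)) atTop id
      (fun _ ↦ P) (multivariateGaussian 0 (J⁻¹ * K * J⁻¹)) ∧
    (multivariateGaussian 0 K).map (fun z ↦ -(J⁻¹.toEuclideanLin z)) =
      multivariateGaussian 0 (J⁻¹ * K * J⁻¹) := by
  set L := J.toEuclideanLin with hL_def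
  have hJ_unit : IsUnit J.det := (Matrix.isUnit_iff_isUnit_det _).1 hJ.isUnit
  have hLsymm : L.IsSymmetric := Matrix.isSymmetric_toEuclideanLin_iff.2 hJ.isHermitian
  obtain ⟨c, hc0, hc⟩ := hJ.exists_pos_mul_norm_sq_le_inner
  have hKpsd := posSemidef_of_eq_integral_mul hD hK
  have hmap : (multivariateGaussian 0 K).map (fun z ↦ -(J⁻¹.toEuclideanLin z)) =
      multivariateGaussian 0 (J⁻¹ * K * J⁻¹) := by
    have hJt : (J⁻¹)ᵀ = J⁻¹ := by
      rw [← Matrix.conjTranspose_eq_transpose_of_trivial]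
      exact hJ.isHermitian.inv
    have h := map_toEuclideanCLM_multivariateGaussian hKpsd (-J⁻¹)
    rw [Matrix.transpose_neg, hJt, Matrix.neg_mul, Matrix.neg_mul, Matrix.mul_neg, neg_neg] at h
    rw [← h]
    congr 1
    ext1 z
    rw [map_neg]
    rfl
  set U : ℕ → Ω → EuclideanSpace ℝ (Fin p) :=
    fun n ω ↦ (√(n : ℝ))⁻¹ • ∑ i ∈ Finset.range n, D (Y i ω) with hU_def
  set β : ℕ → Ω → EuclideanSpace ℝ (Fin p) := fun n ω ↦ -(J⁻¹.toEuclideanLin (U n ω)) with hβ_def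
  set z : ℕ → Ω → EuclideanSpace ℝ (Fin p) := fun n ω ↦ √(n : ℝ) • (θhat n ω - θ₀) with hz_def
  have hβ : ∀ n ω, L (β n ω) = -U n ω := by
    intro n ω
    simp only [hβ_def, map_neg, hL_def, Matrix.toLpLin_apply, Matrix.mulVec_mulVec,
      Matrix.mul_nonsing_inv _ hJ_unit, Matrix.one_mulVec]
  have hcontJ : Continuous fun x : EuclideanSpace ℝ (Fin p) ↦ -(J⁻¹.toEuclideanLin x) :=
    (LinearMap.continuous_of_finiteDimensional _).neg
  have hβ_dist : TendstoInDistribution β atTop id (fun _ ↦ P)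
      (multivariateGaussian 0 (J⁻¹ * K * J⁻¹)) := by
    have h := (tendstoInDistribution_inv_sqrt_smul_sum hlaw hindep hD hD_mean hKpsd
      hK).continuous_comp hcontJ
    refine ⟨h.forall_aemeasurable, by fun_prop, ?_⟩
    convert! h.tendsto using 2
    refine congrArg 𝓝 (Subtype.ext ?_)
    change Measure.map id _ = Measure.map ((fun x ↦ -(J⁻¹.toEuclideanLin x)) ∘ id) _
    rw [Function.comp_id, Measure.map_id, hmap]
  have hzβ : TendstoInMeasure P (fun n ω ↦ z n ω - β n ω) atTop 0 := by
    refine tendstoInMeasure_sub_of_isMinOn_convex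
      (S := fun n ↦ {s | θ₀ + (√(n : ℝ))⁻¹ • s ∈ Θ})
      (A := fun n ω s ↦ ∑ i ∈ Finset.range n,
        (g (Y i ω) (θ₀ + (√(n : ℝ))⁻¹ • s) - g (Y i ω) θ₀))
      (fun C hC ↦ hC.eventually_add_inv_sqrt_smul_mem (hΘ_open.mem_nhds hθ₀)) ?_ hLsymm hc0 hc hβ
      hβ_dist.isStochasticallyBounded ?_ ?_
    · exact fun n ω ↦ convexOn_sum_sub_const_comp_add_smul (hg (Y 0 ω)).1 (fun i ↦ hg (Y i ω)) _ _ _ _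
    · intro s
      have hlocal := tendsto_inv_sqrt_natCast_smul s
      have hmean := (tendsto_natCast_mul_of_isLittleO_norm_sq hR_mean s).add
        (tendsto_const_nhds (x := 1 / 2 * inner ℝ s (L s)))
      rw [zero_add] at hmean
      have hRlim := tendstoInMeasure_sum_of_tendsto_mean_variance hlaw hindep
        (f := fun n y ↦ R y ((√(n : ℝ))⁻¹ • s)) (hlocal.eventually hR)
        (m := 1 / 2 * inner ℝ s (L s)) (hmean.congr' ?_)
        (tendsto_natCast_mul_of_isLittleO_norm_sq hR_var s)
      · refine hRlim.congr' ?_ .rfl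
        filter_upwards [(isCompact_singleton (x := s)).eventually_add_inv_sqrt_smul_mem
          (hΘ_open.mem_nhds hθ₀)] with n hn
        refine .of_forall fun ω ↦ ?_
        simp only [hexp _ _ (hn rfl), Finset.sum_add_distrib, hU_def, inner_smul_left,
          inner_smul_right, sum_inner, ← Finset.mul_sum, conj_trivial]
        ring
      · filter_upwards [eventually_gt_atTop 0] with n hn
        have hn' : (0 : ℝ) < n := by exact_mod_cast hn
        have hsq : (n : ℝ) * ((√(n : ℝ))⁻¹ * (√(n : ℝ))⁻¹) = 1 := by
          rw [← mul_inv, Real.mul_self_sqrt hn'.le, mul_inv_cancel₀ hn'.ne']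
        simp only [map_smul, inner_smul_left, inner_smul_right, conj_trivial]
        linear_combination (-1 / 2 * inner ℝ s (L s)) * hsq
    · refine tendsto_of_tendsto_of_tendsto_of_le_of_le' tendsto_const_nhds hθhat
        (.of_forall fun _ ↦ zero_le) ?_
      -- At n = 0 the rescaling collapses to 0 and `θhat` cannot be recovered from `z`.
      filter_upwards [eventually_gt_atTop 0] with n hn
      have hn' : √(n : ℝ) ≠ 0 := (Real.sqrt_pos.2 (by exact_mod_cast hn)).ne'
      refine measure_mono fun ω hω hω' ↦ hω ?_
      have hpt : θ₀ + (√(n : ℝ))⁻¹ • z n ω = θhat n ω := by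
        simp only [hz_def, inv_smul_smul₀ hn', add_sub_cancel]
      refine ⟨by simpa only [Set.mem_ofPred_eq, hpt] using hω'.1, fun s hs ↦ ?_⟩
      simpa only [Set.mem_ofPred_eq, hpt, Finset.sum_sub_distrib, sub_le_sub_iff_right]
        using hω'.2 hs
  have hz_dist : TendstoInDistribution z atTop id (fun _ ↦ P)
      (multivariateGaussian 0 (J⁻¹ * K * J⁻¹)) :=
    tendstoInDistribution_of_tendstoInMeasure_sub z id hβ_dist hzβ fun n ↦
      AEMeasurable.fun_const_smul ((hθhat_meas n).sub_const θ₀) _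
  exact ⟨hz_dist.isStochasticallyBounded, hzβ, hz_dist, hmap⟩
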